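/- Theorem (local loop lemma). Let $A$ be a (not necessarily finite) set, let $t\colon A^n\to A$ be an $n$-ary operation, let $G$ be a digraph with vertex set $A$ (a binary relation $\rightarrow$ on $A$; loops are allowed), and let $\alpha_{i,j}\in A$ for $i,j\in\{0,\dots,n-1\}$. A walk of length $k\ge 0$ from $v_0$ to $v_k$ is a sequence of vertices $v_0,v_1,\dots,v_k$ with $v_m\rightarrow v_{m+1}$ for all $0\le m<k$; it is a cycle walk of length $k$ if moreover $v_0=v_k$ (other repetitions of vertices are allowed). Suppose that 1. $t$ is idempotent: $t(x,x,\dots,x)=x$ for every $x\in A$; 2. $G$ is compatible with $t$: if $u_j\rightarrow v_j$ for all $j\in\{0,\dots,n-1\}$, then $t(u_0,\dots,u_{n-1})\rightarrow t(v_0,\dots,v_{n-1})$; 3. either $G$ is strongly connected (for any two vertices $u,v$ there is a walk from $u$ to $v$) and contains a cycle walk of every length $k\ge 2$, or $G$ is an undirected graph (the relation $\rightarrow$ is symmetric) that is connected (any two vertices are joined by a walk) and non-bipartite (there is no partition of $A$ into two (possibly empty) classes such that every edge joins vertices of different classes); 4. for every $i\in\{0,\dots,n-1\}$ there is an edge $\alpha_{i,i}\rightarrow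 t(\alpha_{i,0},\alpha_{i,1},\dots,\alpha_{i,n-1})$ in $G$. Then $G$ contains a loop, that is, there is $a\in A$ with $a\rightarrow a$. -/

import Mathlib

namespace LocalLoop

/-- An `n`-ary operation `t` on `A` is idempotent if `t (x, …, x) = x` for every `x`. -/
def IsIdempotentOp {A : Type*} {n : ℕ} (t : (Fin n → A) → A) : Prop :=
  ∀ x : A, t (fun _ => x) = x

/-- A digraph is compatible with `t` if applying `t` pointwise to any `n` edges gives an edge. -/
def IsCompatible {A : Type*} {n : ℕ} (G : Digraph A) (t : (Fin n → A) → A) : Prop :=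
  ∀ u v : Fin n → A, (∀ i, G.Adj (u i) (v i)) → G.Adj (t u) (t v)

/-- The sequence of vertices `w 0, …, w k` is a walk of length `k`. -/
def IsWalk {A : Type*} (G : Digraph A) {k : ℕ} (w : Fin (k + 1) → A) : Prop :=
  ∀ i : Fin k, G.Adj (w i.castSucc) (w i.succ)

/-- A cycle walk is a walk whose first and last vertices agree; repetitions are allowed. -/
def IsCycleWalk {A : Type*} (G : Digraph A) {k : ℕ} (w : Fin (k + 1) → A) : Prop :=
  IsWalk G w ∧ w 0 = w (Fin.last k)

/-- From every vertex there is a walk to every vertex. -/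
def IsStronglyConnected {A : Type*} (G : Digraph A) : Prop :=
  ∀ u v : A, ∃ (k : ℕ) (w : Fin (k + 1) → A), IsWalk G w ∧ w 0 = u ∧ w (Fin.last k) = v

/-- The digraph is an undirected graph, possibly with loops. -/
def IsUndirected {A : Type*} (G : Digraph A) : Prop :=
  ∀ u v : A, G.Adj u v → G.Adj v u

/-- The vertices can be split into two classes such that no edge stays inside a class. -/
def IsBipartite {A : Type*} (G : Digraph A) : Prop :=
  ∃ c : A → Bool, ∀ u v : A, G.Adj u v → c u ≠ c v

end LocalLoop

/-! Label every bi-infinite word over `Fin n` by a vertex, reading only a bounded window, so that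
shifting the word follows an edge unless a long run of a letter `i` surrounds the origin; the two
labels are then `α i i` and `α i j`, with `j` the letter just past the window of the run. Average
labels by applying `t` over one letter after another. A label and its shift have the same average,
since idempotence erases unread letters; compatibility carries edges through; in the exceptional
case averaging over `j` yields the given edge from `α i i` to `t (α i)`. Hence the average has a
loop (`exists_loop_of_labelling`).

The labelling is a marker construction. Marks are long runs, their successors, and peaks, the local
maxima of a ranking of blocks. Distant marks are joined because all large walk lengths occur between
finitely many vertices. Close consecutive marks, the first not a run, are peaks with equal blocks;
local periodicity makes both see the same gap `d` (`peakGap_eq`), so both receive a vertex `c d` on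
a closed walk of length `d`.

In the symmetric case, if the shortest odd closed walk has length `m ≥ 3`, walks of length `m - 2`
form a relation covered by the first case, whose loop is a shorter odd closed walk. -/

namespace LocalLoop

/-! ### Walks of prescribed length -/

/-- `Reach r k u v`: there is an `r`-walk of length `k` from `u` to `v`. -/
def Reach {A : Type*} (r : A → A → Prop) : ℕ → A → A → Prop
  | 0, u, v => u = v
  | k + 1, u, v => ∃ w, r u w ∧ Reach r k w v

section Reach

variable {A : Type*} {r : A → A → Prop}

theorem Reach.trans {k l : ℕ} {u v w : A} (h : Reach r k u v) (h' : Reach r l v w) :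
    Reach r (k + l) u w := by
  induction k generalizing u with
  | zero => cases h; simpa using h'
  | succ k ih =>
    obtain ⟨a, ha, h⟩ := h
    rw [Nat.add_right_comm]
    exact ⟨a, ha, ih h⟩

theorem Reach.single {u v : A} (h : r u v) : Reach r 1 u v := ⟨v, h, rfl⟩

theorem reach_one {u v : A} : Reach r 1 u v ↔ r u v :=
  ⟨by rintro ⟨w, h, rfl⟩; exact h, Reach.single⟩

theorem Reach.cast {k l : ℕ} {u v : A} (h : Reach r k u v) (e : k = l) : Reach r l u v := e ▸ h

theorem Reach.symm (hs : ∀ u v, r u v → r v u) {k : ℕ} {u v : A} (h : Reach r k u v) :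
    Reach r k v u := by
  induction k generalizing u with
  | zero => exact Eq.symm h
  | succ k ih =>
    obtain ⟨a, ha, h⟩ := h
    exact (ih h).trans (Reach.single (hs _ _ ha))

theorem Reach.mul {k : ℕ} {a : A} (h : Reach r k a a) (m : ℕ) : Reach r (m * k) a a := by
  induction m with
  | zero => simp [Reach]
  | succ m ih => rw [Nat.succ_mul]; exact ih.trans h

theorem reach_add {k l : ℕ} {u w : A} (h : Reach r (k + l) u w) :
    ∃ v, Reach r k u v ∧ Reach r l v w := by
  induction k generalizing u with
  | zero => exact ⟨u, rfl, by simpa using h⟩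
  | succ k ih =>
    rw [Nat.add_right_comm] at h
    obtain ⟨a, ha, h⟩ := h
    obtain ⟨v, h1, h2⟩ := ih h
    exact ⟨v, ⟨a, ha, h1⟩, h2⟩

theorem reach_reach {m k : ℕ} {u v : A} (h : Reach r (k * m) u v) : Reach (Reach r m) k u v := by
  induction k generalizing u with
  | zero => simpa [Reach] using h
  | succ k ih =>
    rw [Nat.succ_mul, Nat.add_comm] at h
    obtain ⟨w, h1, h2⟩ := reach_add h
    exact ⟨w, h1, ih h2⟩

theorem Reach.exists_path {k : ℕ} {u v : A} (h : Reach r k u v) :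
    ∃ p : ℕ → A, p 0 = u ∧ p k = v ∧ ∀ i < k, r (p i) (p (i + 1)) := by
  induction k generalizing u with
  | zero => exact ⟨fun _ => u, rfl, h, by simp⟩
  | succ k ih =>
    obtain ⟨a, ha, h⟩ := h
    obtain ⟨p, h0, hk, hp⟩ := ih h
    refine ⟨fun i => Nat.casesOn i u p, rfl, hk, fun i hi => ?_⟩
    cases i with
    | zero => simpa [h0] using ha
    | succ i => exact hp i (by omega)

theorem Reach.compatible {n : ℕ} {t : (Fin n → A) → A}
    (hc : ∀ u v : Fin n → A, (∀ i, r (u i) (v i)) → r (t u) (t v)) (k : ℕ) (u v : Fin n → A)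
    (h : ∀ i, Reach r k (u i) (v i)) : Reach r k (t u) (t v) := by
  induction k generalizing u with
  | zero => exact congrArg t (funext h)
  | succ k ih =>
    choose w h1 h2 using h
    exact ⟨t w, hc _ _ h1, ih w h2⟩

/-- Closed walks of lengths 2 and 3 are inserted on the way; `2i + 3j` takes every value from 2 on.
-/
theorem exists_forall_reach (hconn : ∀ u v, ∃ k, Reach r k u v)
    (h2 : ∃ a, Reach r 2 a a) (h3 : ∃ a, Reach r 3 a a) (u v : A) :
    ∃ L, ∀ l, L ≤ l → Reach r l u v := by
  obtain ⟨a, ha⟩ := h2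
  obtain ⟨b, hb⟩ := h3
  obtain ⟨k1, w1⟩ := hconn u a
  obtain ⟨k2, w2⟩ := hconn a b
  obtain ⟨k3, w3⟩ := hconn b v
  refine ⟨k1 + k2 + k3 + 3, fun l hl => ?_⟩
  obtain ⟨i, j, hij⟩ : ∃ i j, l = k1 + i * 2 + k2 + j * 3 + k3 := by
    rcases Nat.even_or_odd' (l - (k1 + k2 + k3)) with ⟨c, hc | hc⟩
    · exact ⟨c, 0, by omega⟩
    · exact ⟨c - 1, 1, by omega⟩
  exact ((((w1.trans (ha.mul i)).trans w2).trans (hb.mul j)).trans w3).cast hij.symm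

/-- Otherwise the parity of walks from a base vertex is a proper 2-colouring. -/
theorem exists_odd_reach (hs : ∀ u v, r u v → r v u) (hconn : ∀ u v, ∃ k, Reach r k u v)
    (hb : ¬ ∃ c : A → Bool, ∀ u v, r u v → c u ≠ c v) :
    ∃ m, Odd m ∧ ∃ a, Reach r m a a := by
  classical
  by_contra! hno
  apply hb
  by_cases hA : Nonempty A
  · obtain ⟨a⟩ := hA
    refine ⟨fun u => decide (∃ k, Even k ∧ Reach r k a u), fun u v huv hc => ?_⟩
    obtain ⟨k, hk⟩ := hconn a u
    have hkv := hk.trans (Reach.single huv)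
    simp only [decide_eq_decide] at hc
    rcases Nat.even_or_odd k with he | ho
    · obtain ⟨l, hl, hv⟩ := hc.1 ⟨k, he, hk⟩
      exact hno _ (he.add_one.add_even hl) a (hkv.trans (hv.symm hs))
    · obtain ⟨l, hl, hv⟩ := hc.2 ⟨k + 1, ho.add_one, hkv⟩
      exact hno _ (ho.add_even hl) a (hk.trans (hv.symm hs))
  · exact ⟨fun _ => true, fun u => (hA ⟨u⟩).elim⟩

theorem Reach.two_mul (hs : ∀ u v, r u v → r v u) {u v : A} (h : r u v) (m : ℕ) :
    Reach r (2 * m) u u := by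
  rw [Nat.mul_comm]
  exact ((Reach.single h).trans (Reach.single (hs _ _ h))).mul m

theorem Reach.odd_mul (hs : ∀ u v, r u v → r v u) {k : ℕ} {u v : A} (h : Reach r k u v) (m : ℕ) :
    Reach r (k * (2 * m + 1)) u v :=
  (((h.trans (h.symm hs)).mul m).trans h).cast (by ring)

end Reach

theorem IsWalk.reach {A : Type*} {G : Digraph A} {k : ℕ} {w : Fin (k + 1) → A} (h : IsWalk G w) :
    Reach G.Adj k (w 0) (w (Fin.last k)) := by
  induction k with
  | zero => rfl
  | succ k ih =>
    refine ⟨w 1, by simpa using h 0, ?_⟩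
    simpa using ih (w := fun i => w i.succ) fun i => by simpa using h i.succ

end LocalLoop

/-! ### Averaging a function of words over their letters -/

namespace LocalLoop

/-- The sequence `x` translated by `k`. -/
def shift {ι : Type*} (k : ℤ) (x : ℤ → ι) : ℤ → ι := fun i => x (i + k)

section Shift

variable {ι : Type*}

@[simp] theorem shift_apply (k : ℤ) (x : ℤ → ι) (i : ℤ) : shift k x i = x (i + k) := rfl

@[simp] theorem shift_zero (x : ℤ → ι) : shift 0 x = x := by funext i; simp

@[simp] theorem shift_shift (k l : ℤ) (x : ℤ → ι) : shift k (shift l x) = shift (k + l) x := by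
  funext i; simp [add_assoc]

theorem shift_one_update (x : ℤ → ι) (k : ℤ) (j : ι) :
    shift 1 (Function.update x (k + 1) j) = Function.update (shift 1 x) k j := by
  funext i
  simp [Function.update_apply]

end Shift

section Average

variable {A : Type*} {n : ℕ} (t : (Fin n → A) → A)

/-- Apply `t` successively over the coordinates `k, …, k + m - 1` of the argument of `f`. -/
def average : ℕ → ℤ → ((ℤ → Fin n) → A) → (ℤ → Fin n) → A
  | 0, _, f, x => f x
  | m + 1, k, f, x => t fun j => average m (k + 1) f (Function.update x k j)

variable {t}

/-- Restricting to words that agree with `x` before `k` permits a case split on an event decided by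
the earlier letters. -/
theorem average_rel {r : A → A → Prop}
    (hc : ∀ u v : Fin n → A, (∀ i, r (u i) (v i)) → r (t u) (t v)) {f g : (ℤ → Fin n) → A}
    (m : ℕ) (k : ℤ) (x : ℤ → Fin n) (h : ∀ y, (∀ i < k, y i = x i) → r (f y) (g y)) :
    r (average t m k f x) (average t m k g x) := by
  induction m generalizing k x with
  | zero => exact h x fun _ _ => rfl
  | succ m ih =>
    refine hc _ _ fun j => ih _ _ fun y hy => h y fun i hi => ?_
    rw [hy i (by omega), Function.update_of_ne hi.ne]

theorem average_eq_of_forall (hi : IsIdempotentOp t) {f : (ℤ → Fin n) → A} {a : A}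
    (m : ℕ) (k : ℤ) (x : ℤ → Fin n) (h : ∀ y, (∀ i < k, y i = x i) → f y = a) :
    average t m k f x = a := by
  induction m generalizing k x with
  | zero => exact h x fun _ _ => rfl
  | succ m ih =>
    have : (fun j => average t m (k + 1) f (Function.update x k j)) = fun _ => a :=
      funext fun j => ih _ _ fun y hy => h y fun i hi => by
        rw [hy i (by omega), Function.update_of_ne hi.ne]
    rw [average, this, hi]

theorem average_add (f : (ℤ → Fin n) → A) (a b : ℕ) (k : ℤ) (x : ℤ → Fin n) :
    average t (a + b) k f x = average t a k (average t b (k + a) f) x := by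
  induction a generalizing k x with
  | zero => simp [average]
  | succ a ih =>
    rw [Nat.add_right_comm, average, average]
    congr 1
    funext j
    rw [ih]
    congr 2
    push_cast
    ring

theorem average_shift (f : (ℤ → Fin n) → A) (m : ℕ) (k : ℤ) (x : ℤ → Fin n) :
    average t m (k + 1) (fun y => f (shift 1 y)) x = average t m k f (shift 1 x) := by
  induction m generalizing k x with
  | zero => rfl
  | succ m ih =>
    rw [average, average]
    congr 1
    funext j
    rw [ih, shift_one_update]

theorem average_congr {f : (ℤ → Fin n) → A} {lo : ℤ} (m : ℕ) (k : ℤ) (x y : ℤ → Fin n)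
    (hf : ∀ x y, (∀ i, lo ≤ i → i < k + m → x i = y i) → f x = f y)
    (h : ∀ i, lo ≤ i → i < k → x i = y i) : average t m k f x = average t m k f y := by
  induction m generalizing k x y with
  | zero => exact hf _ _ (by simpa using h)
  | succ m ih =>
    rw [average, average]
    congr 1
    funext j
    refine ih _ _ _ (fun x y hxy => hf x y fun i h1 h2 => hxy i h1 (by push_cast at h2; omega))
      fun i h1 h2 => ?_
    rcases eq_or_ne i k with rfl | hne
    · simp
    · rw [Function.update_of_ne hne, Function.update_of_ne hne]
      exact h i h1 (by omega)

/-- A labelling of sequences by vertices along which the shift follows edges, except on an event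
`C` where only the label after averaging the next letter does, yields a loop. -/
theorem exists_loop_of_labelling [NeZero n] {r : A → A → Prop} (hi : IsIdempotentOp t)
    (hc : ∀ u v : Fin n → A, (∀ i, r (u i) (v i)) → r (t u) (t v))
    {α : Fin n → Fin n → A} (hα : ∀ i, r (α i i) (t (α i)))
    (f : (ℤ → Fin n) → A) (B D : ℕ) (C : (ℤ → Fin n) → Prop)
    (hloc : ∀ x y : ℤ → Fin n, (∀ i : ℤ, -B ≤ i → i ≤ B → x i = y i) → f x = f y)
    (hCloc : ∀ x y : ℤ → Fin n, (∀ i : ℤ, i ≤ D → x i = y i) → C x → C y)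
    (hC : ∀ x, C x → f x = α (x 0) (x 0) ∧ f (shift 1 x) = α (x 0) (x (D + 1)))
    (hnC : ∀ x, ¬ C x → r (f x) (f (shift 1 x))) : ∃ a, r a a := by
  let N : ℕ := 2 * B + D + 1
  let lo : ℤ := -(B : ℤ)
  let x₀ : ℤ → Fin n := fun _ => 0
  have hloc' : ∀ x y : ℤ → Fin n, (∀ i : ℤ, lo ≤ i → i < lo + N → x i = y i) → f x = f y :=
    fun x y h => hloc x y fun i h1 h2 => h i h1 (by simp only [N, lo]; push_cast; omega)
  -- The extra last coordinate `lo + N` lies beyond `B`, so `f` does not read it.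
  have hF : average t (N + 1) lo f x₀ = average t N lo f x₀ := by
    rw [average_add]
    congr 1
    funext x
    exact average_eq_of_forall hi _ _ _ fun y hy => hloc' _ _ fun i _ h2 => hy i h2
  -- Here the superfluous coordinate is the first: the shift moves it to `lo - 1`, left of the
  -- window.
  have hG : average t (N + 1) lo (fun y => f (shift 1 y)) x₀ = average t N lo f x₀ := by
    rw [average]
    simp only [average_shift]
    rw [show (fun j => average t N lo f (shift 1 (Function.update x₀ lo j))) =
      fun _ => average t N lo f x₀ from funext fun j => average_congr (lo := lo) _ _ _ _ hloc'
        fun i h1 h2 => absurd h2 (by omega), hi]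
  refine ⟨average t N lo f x₀, ?_⟩
  have key : r (average t (N + 1) lo f x₀) (average t (N + 1) lo (fun y => f (shift 1 y)) x₀) := by
    -- Split so that the letters up to `D`, which decide `C`, are fixed before those from `D + 1` on
    -- are averaged.
    have e : N + 1 = (B + D + 1) + (B + 1) := by simp only [N]; omega
    have e' : lo + ((B + D + 1 : ℕ) : ℤ) = D + 1 := by simp only [lo]; push_cast; omega
    rw [e, average_add _ (B + D + 1) (B + 1), average_add _ (B + D + 1) (B + 1), e']
    refine average_rel hc _ _ _ fun y _ => ?_
    by_cases hy : C y
    · rw [average_eq_of_forall hi (a := α (y 0) (y 0)), average]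
      · rw [show (fun j => average t B ((D : ℤ) + 1 + 1) (fun y => f (shift 1 y))
            (Function.update y ((D : ℤ) + 1) j)) = α (y 0) from funext fun j =>
          average_eq_of_forall hi _ _ _ fun z hz => ?_]
        · exact hα _
        · have hzy : ∀ i : ℤ, i ≤ D → y i = z i := fun i h => by
            rw [hz i (by omega), Function.update_of_ne (by omega)]
          rw [(hC z (hCloc y z hzy hy)).2, ← hzy 0 (by omega), hz _ (by omega)]
          simp
      · intro z hz
        have hzy : ∀ i : ℤ, i ≤ D → y i = z i := fun i h => (hz i (by omega)).symm
        rw [(hC z (hCloc y z hzy hy)).1, hzy 0 (by omega)]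
    · exact average_rel hc _ _ _ fun z hz => hnC z fun h =>
        hy (hCloc z y (fun i h => hz i (by omega)) h)
  rwa [hF, hG] at key

end Average

end LocalLoop

/-! ### Locally constant functions of words -/

namespace LocalLoop

open Filter Topology

section Locality

theorem eventually_agree {ι : Type*} [TopologicalSpace ι] [DiscreteTopology ι] (x : ℤ → ι)
    (B : ℤ) : ∀ᶠ y in 𝓝 x, ∀ i : ℤ, -B ≤ i → i ≤ B → y i = x i := by
  have h : ∀ᶠ y in 𝓝 x, ∀ i ∈ Finset.Icc (-B) B, y i = x i :=
    (Finset.eventually_all _).2 fun i _ =>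
      ((IsLocallyConstant.iff_continuous _).2 (continuous_apply i)).eventually_eq x
  filter_upwards [h] with y hy i h1 h2 using hy i (Finset.mem_Icc.2 ⟨h1, h2⟩)

/-- A locally constant function on bi-infinite words over a finite alphabet is a block code. -/
theorem exists_window {ι β : Type*} [TopologicalSpace ι] [DiscreteTopology ι] [Finite ι]
    {f : (ℤ → ι) → β} (hf : IsLocallyConstant f) :
    ∃ B : ℕ, ∀ x y : ℤ → ι, (∀ i : ℤ, -B ≤ i → i ≤ B → x i = y i) → f x = f y := by
  let U : ℕ → Set (ℤ → ι) := fun B =>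
    {x | ∀ y : ℤ → ι, (∀ i : ℤ, -B ≤ i → i ≤ B → y i = x i) → f y = f x}
  have hmono : Monotone U := fun B B' h x hx y hy =>
    hx y fun i h1 h2 => hy i (by omega) (by omega)
  have hopen : ∀ B, IsOpen (U B) := fun B => by
    rw [isOpen_iff_mem_nhds]
    intro x hx
    filter_upwards [eventually_agree x B] with z hz y hy
    rw [hx y fun i h1 h2 => (hy i h1 h2).trans (hz i h1 h2), hx z hz]
  have hcover : Set.univ ⊆ ⋃ B, U B := by
    intro x _
    obtain ⟨I, u, hu, hs⟩ := isOpen_pi_iff.1 (hf.isOpen_fiber (f x)) x rfl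
    refine Set.mem_iUnion.2 ⟨I.sup Int.natAbs, fun y hy => hs fun i hi => ?_⟩
    have : i.natAbs ≤ I.sup Int.natAbs := Finset.le_sup (f := Int.natAbs) hi
    rw [hy i (by omega) (by omega)]
    exact (hu i hi).2
  obtain ⟨B, hB⟩ := isCompact_univ.elim_directed_cover U hopen hcover
    hmono.directed_le
  exact ⟨B, fun x y h => hB (Set.mem_univ y) x h⟩

theorem isLocallyConstant_of_window {ι β : Type*} [TopologicalSpace ι] [DiscreteTopology ι]
    {f : (ℤ → ι) → β} (B : ℤ)
    (h : ∀ x y : ℤ → ι, (∀ i : ℤ, -B ≤ i → i ≤ B → x i = y i) → f x = f y) :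
    IsLocallyConstant f :=
  (IsLocallyConstant.iff_eventually_eq f).2 fun x => by
    filter_upwards [eventually_agree x B] with y hy using h y x hy

theorem isLocallyConstant_shift {ι β : Type*} [TopologicalSpace ι]
    {f : (ℤ → ι) → β} (hf : IsLocallyConstant f) (k : ℤ) :
    IsLocallyConstant fun x => f (shift k x) :=
  hf.comp_continuous (continuous_pi fun i => continuous_apply (i + k))

theorem isLocallyConstant_sInf {X : Type*} [TopologicalSpace X] {s : X → Set ℕ}
    (hs : ∀ k, IsLocallyConstant fun x => k ∈ s x) (hne : ∀ x, (s x).Nonempty) :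
    IsLocallyConstant fun x => sInf (s x) :=
  (IsLocallyConstant.iff_eventually_eq _).2 fun x => by
    have h : ∀ᶠ y in 𝓝 x, ∀ k ∈ Finset.range (sInf (s x) + 1), (k ∈ s y) = (k ∈ s x) :=
      (Finset.eventually_all _).2 fun k _ => (hs k).eventually_eq x
    filter_upwards [h] with y hy
    have h1 : sInf (s x) ∈ s y := (hy _ (by simp)).mpr (Nat.sInf_mem (hne x))
    refine le_antisymm (Nat.sInf_le h1) (not_lt.1 fun hlt => ?_)
    exact Nat.notMem_of_lt_sInf hlt
      ((hy _ (Finset.mem_range.2 (by omega))).mp (Nat.sInf_mem (hne y)))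

theorem isLocallyConstant_family {X β γ : Type*} [TopologicalSpace X] {f : β → X → γ}
    (hf : ∀ b, IsLocallyConstant (f b)) {g : X → β} (hg : IsLocallyConstant g) :
    IsLocallyConstant fun x => f (g x) x :=
  (IsLocallyConstant.iff_eventually_eq _).2 fun x => by
    filter_upwards [hg.eventually_eq x, (hf (g x)).eventually_eq x] with y h1 h2
    rw [h1, h2]

end Locality

/-! ### Marks: peaks and long runs -/

section Marks

variable {ι : Type*} [Fintype ι]

/-- The word is constant on the long window `[-K, 3K + 3]`. -/
def IsRun (K : ℕ) (x : ℤ → ι) : Prop := ∀ i : ℤ, -K ≤ i → i < 3 * K + 3 → x i = x (i + 1)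

open Classical in
/-- A rank of the block on `[0, 2K + 1]`, injective on nonconstant blocks, zero on the others. -/
noncomputable def blockRank (K : ℕ) (x : ℤ → ι) : ℕ :=
  if ∀ i : ℤ, 0 ≤ i → i < 2 * K + 1 → x i = x (i + 1) then 0
  else Fintype.equivFin (Fin (2 * K + 2) → ι) (fun i => x i) + 1

/-- The block at the origin is nonconstant and of maximal rank among the blocks within `K`. -/
def IsPeak (K : ℕ) (x : ℤ → ι) : Prop :=
  0 < blockRank K x ∧ ∀ k : ℤ, -K ≤ k → k ≤ K → blockRank K (shift k x) ≤ blockRank K x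

/-- The origin carries a mark: a peak, a position in a long run, or the one following it. -/
def IsMark (K : ℕ) (x : ℤ → ι) : Prop := IsPeak K x ∨ IsRun K x ∨ IsRun K (shift (-1) x)

/-- Distance from the origin to the nearest other peak within `K`, or zero. -/
noncomputable def peakGap (K : ℕ) (x : ℤ → ι) : ℕ :=
  sInf {d : ℕ | 0 < d ∧ d ≤ K ∧ (IsPeak K (shift d x) ∨ IsPeak K (shift (-d) x))}

variable {K : ℕ} {x : ℤ → ι}

theorem blockRank_pos : 0 < blockRank K x ↔ ∃ i : ℤ, 0 ≤ i ∧ i < 2 * K + 1 ∧ x i ≠ x (i + 1) := by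
  unfold blockRank
  split_ifs with h
  · simpa using h
  · simpa using h

theorem blockRank_congr {x y : ℤ → ι} (h : ∀ i : ℤ, 0 ≤ i → i < 2 * K + 2 → x i = y i) :
    blockRank K x = blockRank K y := by
  have h1 : (∀ i : ℤ, 0 ≤ i → i < 2 * K + 1 → x i = x (i + 1)) ↔
      (∀ i : ℤ, 0 ≤ i → i < 2 * K + 1 → y i = y (i + 1)) := by
    refine forall_congr' fun i => forall_congr' fun h0 => forall_congr' fun h1 => ?_
    rw [h i h0 (by omega), h (i + 1) (by omega) (by omega)]
  have h2 : (fun i : Fin (2 * K + 2) => x i) = fun i : Fin (2 * K + 2) => y i :=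
    funext fun i => h _ (by omega) (by omega)
  unfold blockRank
  rw [h2]
  split_ifs with a b b
  exacts [rfl, absurd (h1.1 a) b, absurd (h1.2 b) a, rfl]

theorem eq_of_blockRank_eq {x y : ℤ → ι} (hx : 0 < blockRank K x)
    (h : blockRank K x = blockRank K y) : ∀ i : ℤ, 0 ≤ i → i < 2 * K + 2 → x i = y i := by
  obtain ⟨j, hj0, hj1, hj⟩ := blockRank_pos.1 hx
  obtain ⟨k, hk0, hk1, hk⟩ := blockRank_pos.1 (h ▸ hx)
  unfold blockRank at h
  rw [if_neg fun hc => hj (hc j hj0 hj1), if_neg fun hc => hk (hc k hk0 hk1)] at h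
  have e := congrFun ((Fintype.equivFin _).injective (Fin.ext (Nat.succ_injective h)))
  intro i h0 h1
  simpa [h0] using e ⟨i.toNat, by omega⟩

theorem IsPeak.blockRank_eq {d : ℤ} (h : IsPeak K x) (h' : IsPeak K (shift d x)) (h0 : -K ≤ d)
    (h1 : d ≤ K) : blockRank K (shift d x) = blockRank K x := by
  refine le_antisymm (h.2 d h0 h1) ?_
  have := h'.2 (-d) (by omega) (by omega)
  simpa using this

theorem IsPeak.periodic {d : ℤ} (h : IsPeak K x) (h' : IsPeak K (shift d x)) (h0 : -K ≤ d)
    (h1 : d ≤ K) : ∀ i : ℤ, 0 ≤ i → i < 2 * K + 2 → x i = x (i + d) := fun i hi hi' =>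
  eq_of_blockRank_eq h.1 (h.blockRank_eq h' h0 h1).symm i hi hi'

/-- The `K`-neighbourhood of `m` is covered by those of the two peaks, whose ranks coincide. -/
theorem IsPeak.shift_of_agree {d m : ℤ} (h : IsPeak K x) (h' : IsPeak K (shift d x))
    (hm : 0 ≤ m ∧ m ≤ d ∨ d ≤ m ∧ m ≤ 0) (h0 : -K ≤ d) (h1 : d ≤ K)
    (hx : ∀ i : ℤ, 0 ≤ i → i < 2 * K + 2 → x i = x (i + m)) : IsPeak K (shift m x) := by
  have e : blockRank K (shift m x) = blockRank K x :=
    blockRank_congr fun i hi hi' => (hx i hi hi').symm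
  refine ⟨e ▸ h.1, fun k hk hk' => ?_⟩
  rw [e, shift_shift]
  by_cases hc : -K ≤ k + m ∧ k + m ≤ K
  · exact h.2 _ hc.1 hc.2
  · rw [← h.blockRank_eq h' h0 h1]
    have := h'.2 (k + m - d) (by omega) (by omega)
    simpa using this

/-- Repetition of the block at `-m` and at `d` forces its repetition at `m`. Hence a short gap on
one side of a peak cannot be undercut by the other side. -/
theorem IsPeak.between_right {m d : ℤ} (hl : IsPeak K (shift (-m) x)) (h : IsPeak K x)
    (hr : IsPeak K (shift d x)) (hm : 0 < m) (hmd : m < d) (hd : d ≤ K) :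
    IsPeak K (shift m x) := by
  have p1 := h.periodic hl (by omega) (by omega)
  have p2 := h.periodic hr (by omega) (by omega)
  refine h.shift_of_agree hr (Or.inl ⟨hm.le, hmd.le⟩) (by omega) (by omega) fun i h0 h1 => ?_
  by_cases hi : i + m < 2 * K + 2
  · rw [p1 (i + m) (by omega) hi]
    congr 1
    ring
  -- From `i + m` go back by `d`, back by `m`, forward by `d`. The indices stay in the block because
  -- its length `2K + 2` exceeds `m + d`.
  · rw [p1 i h0 h1]
    have e1 := p2 (i + m - d) (by omega) (by omega)
    have e2 := p2 (i - d) (by omega) (by omega)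
    have e3 := p1 (i + m - d) (by omega) (by omega)
    have e4 := p1 i (by omega) (by omega)
    ring_nf at e1 e2 e3 e4 ⊢
    rw [← e1, e3, e2, ← e4]

theorem IsPeak.between_left {m d : ℤ} (hl : IsPeak K (shift (-d) x)) (h : IsPeak K x)
    (hr : IsPeak K (shift m x)) (hm : 0 < m) (hmd : m < d) (hd : d ≤ K) :
    IsPeak K (shift (-m) x) := by
  have p1 := h.periodic hl (by omega) (by omega)
  have p2 := h.periodic hr (by omega) (by omega)
  refine h.shift_of_agree hl (Or.inr ⟨by omega, by omega⟩) (by omega) (by omega) fun i h0 h1 => ?_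
  by_cases hi : m ≤ i
  · have e1 := p2 (i - m) (by omega) (by omega)
    ring_nf at e1 ⊢
    exact e1.symm
  · have e1 := p1 (i - m + d) (by omega) (by omega)
    have e2 := p2 (i - m + d) (by omega) (by omega)
    have e3 := p1 (i + d) (by omega) (by omega)
    ring_nf at e1 e2 e3 ⊢
    rw [← e3, ← e2, e1]

theorem IsPeak.not_isRun (h : IsPeak K x) : ¬ IsRun K x := fun hr => by
  obtain ⟨i, h0, h1, h2⟩ := blockRank_pos.1 h.1
  exact h2 (hr i (by omega) (by omega))

theorem IsPeak.not_isRun_shift (h : IsPeak K x) : ¬ IsRun K (shift (-1) x) := fun hr => by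
  obtain ⟨i, h0, h1, h2⟩ := blockRank_pos.1 h.1
  have := hr (i + 1) (by omega) (by omega)
  simp at this
  exact h2 this

theorem mem_peakGap_set {d : ℕ} (hd : 0 < d) (hK : d ≤ K)
    (h : IsPeak K (shift d x) ∨ IsPeak K (shift (-d) x)) :
    d ∈ {d : ℕ | 0 < d ∧ d ≤ K ∧ (IsPeak K (shift d x) ∨ IsPeak K (shift (-d) x))} := ⟨hd, hK, h⟩

/-- Two consecutive peaks at distance at most `K` both have this distance as their gap. -/
theorem peakGap_eq {d : ℕ} (hd : 0 < d) (hK : d ≤ K) (h : IsPeak K x) (h' : IsPeak K (shift d x))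
    (hno : ∀ j : ℕ, 0 < j → j < d → ¬ IsPeak K (shift j x)) :
    peakGap K x = d ∧ peakGap K (shift d x) = d := by
  constructor
  · have hmem := mem_peakGap_set hd hK (Or.inl h')
    refine le_antisymm (Nat.sInf_le hmem) (not_lt.1 fun hlt => ?_)
    obtain ⟨h0, h1, h2⟩ := Nat.sInf_mem ⟨d, hmem⟩
    change peakGap K x < d at hlt
    change 0 < peakGap K x at h0
    change IsPeak K (shift (peakGap K x : ℕ) x) ∨ IsPeak K (shift (-(peakGap K x : ℕ)) x) at h2
    refine hno _ h0 hlt ?_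
    rcases h2 with h2 | h2
    · exact h2
    · exact h2.between_right h h' (by omega) (by omega) (by omega)
  · have hmem := mem_peakGap_set (x := shift d x) hd hK (Or.inr (by simpa using h))
    refine le_antisymm (Nat.sInf_le hmem) (not_lt.1 fun hlt => ?_)
    obtain ⟨h0, h1, h2⟩ := Nat.sInf_mem ⟨d, hmem⟩
    change peakGap K (shift d x) < d at hlt
    change 0 < peakGap K (shift d x) at h0
    change IsPeak K (shift (peakGap K (shift d x) : ℕ) (shift d x)) ∨
      IsPeak K (shift (-(peakGap K (shift d x) : ℕ)) (shift d x)) at h2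
    generalize peakGap K (shift d x) = m at *
    have key : IsPeak K (shift (-m) (shift d x)) := by
      rcases h2 with h2 | h2
      · exact IsPeak.between_left (d := d) (by simpa using h) h' h2 (by omega) (by omega) (by omega)
      · exact h2
    refine hno (d - m) (by omega) (by omega) ?_
    rw [shift_shift] at key
    rwa [show (((d - m : ℕ) : ℤ)) = -m + d by omega]

/-- Marks occur frequently in every translation invariant direction. -/
theorem frequently_isMark (K : ℕ) (x : ℤ → ι) {l : Filter ℤ} [l.NeBot]
    (hl : ∀ k : ℤ, Tendsto (fun p => p + k) l l) : ∃ᶠ p in l, IsMark K (shift p x) := by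
  classical
  let R : ℤ → ℕ := fun p => blockRank K (shift p x)
  let C : ℕ := Fintype.card (Fin (2 * K + 2) → ι)
  have hbound : ∀ p, R p ≤ C := fun p => by
    simp only [R, blockRank]
    split_ifs
    · exact Nat.zero_le _
    · exact (Fintype.equivFin (Fin (2 * K + 2) → ι) _).isLt
  let S : Finset ℕ := (Finset.range (C + 1)).filter fun v => ∃ᶠ p in l, R p = v
  have hS : S.Nonempty := by
    by_contra hne
    have : ∀ᶠ p in l, ∀ v ∈ Finset.range (C + 1), R p ≠ v :=
      (Finset.eventually_all _).2 fun v hv => by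
        by_contra hc
        exact hne ⟨v, Finset.mem_filter.2 ⟨hv, hc⟩⟩
    obtain ⟨p, hp⟩ := this.exists
    exact hp (R p) (Finset.mem_range.2 (Nat.lt_succ_of_le (hbound p))) rfl
  -- The largest rank taken frequently; eventually no rank exceeds it.
  obtain ⟨v, hvS, hmax⟩ := S.exists_max_image id hS
  have hv : ∃ᶠ p in l, R p = v := (Finset.mem_filter.1 hvS).2
  have hle : ∀ᶠ p in l, R p ≤ v := by
    have : ∀ᶠ p in l, ∀ w ∈ Finset.range (C + 1), v < w → R p ≠ w :=
      (Finset.eventually_all _).2 fun w hw => by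
        by_cases hvw : v < w
        · have : ¬ ∃ᶠ p in l, R p = w := fun hf =>
            absurd (hmax w (Finset.mem_filter.2 ⟨hw, hf⟩)) (not_le.2 hvw)
          filter_upwards [not_frequently.1 this] with p hp _ using hp
        · exact Eventually.of_forall fun p h => absurd h hvw
    filter_upwards [this] with p hp
    by_contra hc
    exact hp (R p) (Finset.mem_range.2 (Nat.lt_succ_of_le (hbound p))) (not_le.1 hc) rfl
  -- Rank eventually zero makes the word eventually constant, hence full of runs; otherwise frequent
  -- occurrences of `v` are peaks.
  rcases Nat.eq_zero_or_pos v with hv0 | hv0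
  · have hstep : ∀ᶠ p in l, x p = x (p + 1) := by
      filter_upwards [hle] with p hp
      by_contra hne
      have : 0 < R p := blockRank_pos.2 ⟨0, le_rfl, by omega, by simpa [add_comm] using hne⟩
      omega
    have hrun : ∀ᶠ p in l, ∀ i ∈ Finset.Ico (-K : ℤ) (3 * K + 3), x (p + i) = x (p + i + 1) :=
      (Finset.eventually_all _).2 fun i _ => (hl i).eventually hstep
    refine Eventually.frequently ?_
    filter_upwards [hrun] with p hp
    refine Or.inr (Or.inl fun i h0 h1 => ?_)
    have := hp i (Finset.mem_Ico.2 ⟨h0, h1⟩)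
    simp only [shift_apply]
    rw [add_comm i p, this]
    congr 1
    ring
  · have hnear : ∀ᶠ p in l, ∀ k ∈ Finset.Icc (-K : ℤ) K, R (p + k) ≤ v :=
      (Finset.eventually_all _).2 fun k _ => (hl k).eventually hle
    refine (hv.and_eventually hnear).mono fun p hp => Or.inl ?_
    have e : blockRank K (shift p x) = v := hp.1
    refine ⟨by omega, fun k h0 h1 => ?_⟩
    have := hp.2 k (Finset.mem_Icc.2 ⟨h0, h1⟩)
    rw [e, shift_shift, add_comm k p]
    exact this

theorem exists_isMark_right (K : ℕ) (x : ℤ → ι) : ∃ r : ℕ, 0 < r ∧ IsMark K (shift r x) := by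
  obtain ⟨p, hp, hp'⟩ := ((frequently_isMark K x (l := atTop)
    fun k => tendsto_atTop_add_const_right _ k tendsto_id).and_eventually
      (eventually_gt_atTop 0)).exists
  exact ⟨p.toNat, by omega, by rwa [Int.toNat_of_nonneg hp'.le]⟩

theorem exists_isMark_left (K : ℕ) (x : ℤ → ι) : ∃ r : ℕ, IsMark K (shift (-r) x) := by
  obtain ⟨p, hp, hp'⟩ := ((frequently_isMark K x (l := atBot)
    fun k => tendsto_atBot_add_const_right _ k tendsto_id).and_eventually
      (eventually_lt_atBot 0)).exists
  exact ⟨(-p).toNat, by rwa [Int.toNat_of_nonneg (by omega), neg_neg]⟩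

section

variable [TopologicalSpace ι] [DiscreteTopology ι]

theorem isLocallyConstant_isRun {κ : Type*} [TopologicalSpace κ] [DiscreteTopology κ] (K : ℕ) :
    IsLocallyConstant (IsRun (ι := κ) K) :=
  isLocallyConstant_of_window (3 * K + 3) fun x y h => propext <|
    forall_congr' fun i => forall_congr' fun h0 => forall_congr' fun h1 => by
      rw [h i (by omega) (by omega), h (i + 1) (by omega) (by omega)]

theorem isLocallyConstant_isPeak (K : ℕ) : IsLocallyConstant (IsPeak (ι := ι) K) :=
  isLocallyConstant_of_window (3 * K + 3) fun x y h => by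
    have e : ∀ k : ℤ, -K ≤ k → k ≤ K → blockRank K (shift k x) = blockRank K (shift k y) :=
      fun k h0 h1 => blockRank_congr fun i h2 h3 => h _ (by omega) (by omega)
    have e0 : blockRank K x = blockRank K y := by simpa using e 0 (by omega) (by omega)
    refine propext (and_congr (by rw [e0]) ?_)
    refine forall_congr' fun i => forall_congr' fun h0 => forall_congr' fun h1 => ?_
    rw [e i h0 h1, e0]

theorem isLocallyConstant_isMark (K : ℕ) : IsLocallyConstant (IsMark (ι := ι) K) :=
  (isLocallyConstant_isPeak K).comp₂ ((isLocallyConstant_isRun K).comp₂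
    (isLocallyConstant_shift (isLocallyConstant_isRun K) (-1)) Or) Or

/-- The set of distances may be empty, but the bound `d ≤ K` leaves finitely many conditions. -/
theorem isLocallyConstant_peakGap (K : ℕ) : IsLocallyConstant (peakGap (ι := ι) K) :=
  (IsLocallyConstant.iff_eventually_eq _).2 fun x => by
    have h : ∀ᶠ y in 𝓝 x, ∀ d ∈ Finset.range (K + 1),
        (IsPeak K (shift d y) ∨ IsPeak K (shift (-d) y)) =
          (IsPeak K (shift d x) ∨ IsPeak K (shift (-d) x)) :=
      (Finset.eventually_all _).2 fun d _ =>
        ((isLocallyConstant_shift (isLocallyConstant_isPeak K) d).comp₂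
          (isLocallyConstant_shift (isLocallyConstant_isPeak K) (-d)) Or).eventually_eq x
    filter_upwards [h] with y hy
    refine congrArg sInf (Set.ext fun d => and_congr_right fun _ => and_congr_right fun hd => ?_)
    rw [hy d (Finset.mem_range.2 (by omega))]

end

end Marks

end LocalLoop

/-! ### The labelling by walks between marks -/

namespace LocalLoop

section Labelling

variable {A : Type*} {n : ℕ}

open Classical in
/-- The vertex assigned to a marked position. -/
noncomputable def markValue (K : ℕ) (α : Fin n → Fin n → A) (c : ℕ → A) (x : ℤ → Fin n) : A :=
  if IsPeak K x then c (peakGap K x) else α (x 0) (x (3 * K + 3))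

/-- Distance to the last mark at or before the origin. -/
noncomputable def leftDist (K : ℕ) (x : ℤ → Fin n) : ℕ := sInf {l : ℕ | IsMark K (shift (-l) x)}

/-- Distance to the first mark after the origin. -/
noncomputable def rightDist (K : ℕ) (x : ℤ → Fin n) : ℕ :=
  sInf {r : ℕ | 0 < r ∧ IsMark K (shift r x)}

/-- The vertex at the origin on the walk `P` joining the values of the surrounding marks. -/
noncomputable def label (K : ℕ) (α : Fin n → Fin n → A) (c : ℕ → A) (P : A → A → ℕ → ℕ → A)
    (x : ℤ → Fin n) : A :=
  P (markValue K α c (shift (-leftDist K x) x)) (markValue K α c (shift (rightDist K x) x))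
    (leftDist K x + rightDist K x) (leftDist K x)

variable {K : ℕ} {α : Fin n → Fin n → A} {c : ℕ → A} {P : A → A → ℕ → ℕ → A} {x : ℤ → Fin n}

theorem isLocallyConstant_markValue : IsLocallyConstant (markValue K α c) := by
  classical
  refine (IsLocallyConstant.iff_eventually_eq _).2 fun x => ?_
  filter_upwards [(isLocallyConstant_isPeak K).eventually_eq x,
    (isLocallyConstant_peakGap K).eventually_eq x, eventually_agree x (3 * K + 3)] with y h1 h2 h3
  unfold markValue
  rw [h2, h3 0 (by omega) (by omega), h3 (3 * K + 3) (by omega) (by omega)]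
  exact if_congr (iff_of_eq h1) rfl rfl

theorem isLocallyConstant_label : IsLocallyConstant (label K α c P) := by
  have hl : IsLocallyConstant (leftDist (n := n) K) :=
    isLocallyConstant_sInf (fun k => isLocallyConstant_shift (isLocallyConstant_isMark K) (-k))
      fun x => exists_isMark_left K x
  have hr : IsLocallyConstant (rightDist (n := n) K) :=
    isLocallyConstant_sInf (fun k => (IsLocallyConstant.const (0 < k)).comp₂
      (isLocallyConstant_shift (isLocallyConstant_isMark K) k) And)
      fun x => exists_isMark_right K x
  have h1 : IsLocallyConstant fun x : ℤ → Fin n =>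
      markValue K α c (shift (-leftDist K x) x) :=
    isLocallyConstant_family (f := fun (b : ℕ) x => markValue K α c (shift (-b) x))
      (fun b => isLocallyConstant_shift isLocallyConstant_markValue _) hl
  have h2 : IsLocallyConstant fun x : ℤ → Fin n =>
      markValue K α c (shift (rightDist K x) x) :=
    isLocallyConstant_family (f := fun (b : ℕ) x => markValue K α c (shift b x))
      (fun b => isLocallyConstant_shift isLocallyConstant_markValue _) hr
  exact (h1.prodMk (h2.prodMk (hl.prodMk hr))).comp
    fun q => P q.1 q.2.1 (q.2.2.1 + q.2.2.2) q.2.2.1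

theorem leftDist_spec (K : ℕ) (x : ℤ → Fin n) : IsMark K (shift (-leftDist K x) x) :=
  Nat.sInf_mem (exists_isMark_left K x)

theorem rightDist_spec (K : ℕ) (x : ℤ → Fin n) :
    0 < rightDist K x ∧ IsMark K (shift (rightDist K x) x) :=
  Nat.sInf_mem (exists_isMark_right K x)

theorem leftDist_le {l : ℕ} (h : IsMark K (shift (-l) x)) : leftDist K x ≤ l := Nat.sInf_le h

theorem rightDist_le {r : ℕ} (h0 : 0 < r) (h : IsMark K (shift r x)) : rightDist K x ≤ r :=
  Nat.sInf_le ⟨h0, h⟩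

theorem leftDist_eq_zero (h : IsMark K x) : leftDist K x = 0 :=
  Nat.le_zero.1 (leftDist_le (by simpa using h))

theorem leftDist_shift (h : ¬ IsMark K (shift 1 x)) :
    leftDist K (shift 1 x) = leftDist K x + 1 := by
  refine le_antisymm (leftDist_le ?_) ?_
  · have := leftDist_spec K x
    rw [shift_shift]
    convert this using 2
    push_cast
    ring
  · have h1 := leftDist_spec K (shift 1 x)
    rcases Nat.eq_zero_or_pos (leftDist K (shift 1 x)) with h0 | h0
    · rw [h0] at h1
      exact absurd (by simpa using h1) h
    · have := leftDist_le (K := K) (x := x) (l := leftDist K (shift 1 x) - 1) (by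
        rw [shift_shift] at h1
        convert h1 using 2
        omega)
      omega

theorem rightDist_shift (h : ¬ IsMark K (shift 1 x)) :
    rightDist K x = rightDist K (shift 1 x) + 1 := by
  refine le_antisymm (rightDist_le (by omega) ?_) ?_
  · have := (rightDist_spec K (shift 1 x)).2
    rw [shift_shift] at this
    exact_mod_cast this
  · have h1 := rightDist_spec K x
    rcases Nat.eq_or_lt_of_le h1.1 with h0 | h0
    · rw [← h0] at h1
      exact absurd (by simpa using h1.2) h
    · have := rightDist_le (K := K) (x := shift 1 x) (r := rightDist K x - 1) (by omega) (by
        rw [shift_shift]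
        convert h1.2 using 2
        omega)
      omega

theorem rightDist_eq_one (h : IsMark K (shift 1 x)) : rightDist K x = 1 :=
  le_antisymm (rightDist_le one_pos (by simpa using h)) (rightDist_spec K x).1

theorem label_of_isMark (hP : ∀ u v d, P u v d 0 = u) (h : IsMark K x) :
    label K α c P x = markValue K α c x := by
  unfold label
  rw [leftDist_eq_zero h, hP]
  simp

/-- Neither position is a peak, as the block of a peak is not constant. The offset `3K + 3` points
to the last letter of the run window, and after the shift to the first letter beyond it. -/
theorem label_of_isRun (hP : ∀ u v d, P u v d 0 = u) (h : IsRun K x) :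
    label K α c P x = α (x 0) (x 0) ∧
      label K α c P (shift 1 x) = α (x 0) (x (3 * K + 3 + 1)) := by
  have hconst : ∀ j : ℕ, (j : ℤ) ≤ 3 * K + 3 → x j = x 0 := by
    intro j
    induction j with
    | zero => simp
    | succ j ih =>
      intro hj
      push_cast at hj ⊢
      rw [← h j (by omega) (by omega), ih (by omega)]
  have h1 : IsRun K (shift (-1) (shift 1 x)) := by simpa using h
  rw [label_of_isMark hP (Or.inr (Or.inl h)), label_of_isMark hP (Or.inr (Or.inr h1))]
  unfold markValue
  rw [if_neg fun hp => hp.not_isRun h, if_neg fun hp => hp.not_isRun_shift h1]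
  have e1 := hconst (3 * K + 3) (by push_cast; omega)
  have e2 := hconst 1 (by omega)
  push_cast at e1 e2
  simp [e1, e2]

/-- Consecutive marks, the first outside a long run, are joined by a walk of the right length. -/
theorem reach_markValue {r : A → A → Prop} {d : ℕ}
    (hc : ∀ k, 2 ≤ k → Reach r k (c k) (c k))
    (hK : ∀ l, K < l → ∀ x y : ℤ → Fin n, Reach r l (markValue K α c x) (markValue K α c y))
    (hd : 0 < d) (hx : IsMark K x) (hx' : IsMark K (shift d x)) (hrun : ¬ IsRun K x)
    (hno : ∀ j : ℕ, 0 < j → j < d → ¬ IsMark K (shift j x)) :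
    Reach r d (markValue K α c x) (markValue K α c (shift d x)) := by
  by_cases hdK : K < d
  · exact hK d hdK _ _
  -- A run at `d - 1` would be an intermediate mark, or the origin itself if `d = 1`.
  have hprev : ¬ IsRun K (shift (-1) (shift d x)) := by
    intro h
    rw [shift_shift, show -1 + (d : ℤ) = ((d - 1 : ℕ) : ℤ) by omega] at h
    rcases Nat.eq_or_lt_of_le hd with h1 | h1
    · rw [← h1] at h
      exact hrun (by simpa using h)
    · exact hno (d - 1) (by omega) (by omega) (Or.inr (Or.inl h))
  rcases hx' with hp | hr | hr
  · rcases hx with hp0 | hr0 | hr0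
    · obtain ⟨e1, e2⟩ := peakGap_eq hd (by omega) hp0 hp fun j h0 h1 h => hno j h0 h1 (Or.inl h)
      unfold markValue
      rw [if_pos hp0, if_pos hp, e1, e2]
      refine hc d (not_lt.1 fun hlt => ?_)
      obtain rfl : d = 1 := by omega
      obtain ⟨i, h0, h1, hne⟩ := blockRank_pos.1 hp0.1
      exact hne (hp0.periodic hp (by omega) (by omega) i h0 (by omega))
    · exact absurd hr0 hrun
    -- Since `d ≤ K`, the block of the peak fits inside the window of the run at `-1`.
    · obtain ⟨i, h0, h1, hne⟩ := blockRank_pos.1 hp.1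
      have := hr0 (i + d + 1) (by omega) (by omega)
      simp only [shift_apply] at hne this
      ring_nf at hne this
      exact absurd this hne
  -- The run at `d` extends one step left; only `i = -K` is new. A peak at the origin would have its
  -- block inside this run; a run at `-1` contains the missing equality.
  · refine absurd (fun i h0 h1 => ?_) hprev
    rcases eq_or_lt_of_le h0 with rfl | h0'
    · rcases hx with hp0 | hr0 | hr0
      · obtain ⟨i, h2, h3, hne⟩ := blockRank_pos.1 hp0.1
        have := hr (i - d) (by omega) (by omega)
        simp only [shift_apply] at this
        ring_nf at hne this
        exact absurd this hne
      · exact absurd hr0 hrun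
      · have := hr0 (-K + d) (by omega) (by omega)
        simp only [shift_apply] at this ⊢
        ring_nf at this ⊢
        exact this
    · have := hr (i - 1) (by omega) (by omega)
      simp only [shift_apply] at this ⊢
      ring_nf at this ⊢
      exact this
  · exact absurd hr hprev

/-- Both labels lie on one chosen walk between consecutive marks: one step apart, or with the second
at its end, a mark. -/
theorem label_rel {r : A → A → Prop}
    (hP : ∀ u v d, P u v d 0 = u)
    (hP' : ∀ u v d, Reach r d u v → P u v d d = v ∧ ∀ i < d, r (P u v d i) (P u v d (i + 1)))
    (hc : ∀ k, 2 ≤ k → Reach r k (c k) (c k))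
    (hK : ∀ l, K < l → ∀ x y : ℤ → Fin n, Reach r l (markValue K α c x) (markValue K α c y))
    (hrun : ¬ IsRun K x) : r (label K α c P x) (label K α c P (shift 1 x)) := by
  have hl := leftDist_spec K x
  have hr := rightDist_spec K x
  have key : Reach r (leftDist K x + rightDist K x) (markValue K α c (shift (-leftDist K x) x))
      (markValue K α c (shift (rightDist K x) x)) := by
    have := reach_markValue (α := α) (x := shift (-leftDist K x) x)
      (d := leftDist K x + rightDist K x) hc hK (by omega) hl (by simpa using hr.2) ?_ ?_
    · simpa using this
    -- If the left mark were a run at a negative position, its successor would be a nearer mark.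
    · intro h
      rcases Nat.eq_zero_or_pos (leftDist K x) with h0 | h0
      · rw [h0] at h
        exact hrun (by simpa using h)
      · have := leftDist_le (K := K) (x := x) (l := leftDist K x - 1) (Or.inr (Or.inr (by
          rw [shift_shift]
          convert h using 2
          omega)))
        omega
    · intro j h0 h1 h
      rw [shift_shift] at h
      by_cases hj : j ≤ leftDist K x
      · have := leftDist_le (K := K) (x := x) (l := leftDist K x - j) (by
          convert h using 2
          omega)
        omega
      · have := rightDist_le (K := K) (x := x) (r := j - leftDist K x) (by omega) (by
          convert h using 2
          omega)
        omega
  obtain ⟨hend, hstep⟩ := hP' _ _ _ key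
  have h := hstep (leftDist K x) (by omega)
  by_cases hm : IsMark K (shift 1 x)
  · rw [label_of_isMark hP hm]
    unfold label
    rw [rightDist_eq_one hm] at h hend ⊢
    rw [hend] at h
    simpa using h
  · have e1 := leftDist_shift hm
    have e2 := rightDist_shift hm
    have e3 : label K α c P (shift 1 x) =
        P (markValue K α c (shift (-leftDist K x) x)) (markValue K α c (shift (rightDist K x) x))
          (leftDist K x + rightDist K x) (leftDist K x + 1) := by
      unfold label
      rw [shift_shift, shift_shift, e1, e2]
      congr 1
      · congr 2; push_cast; ring
      · omega
    rw [e3]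
    exact h

end Labelling

/-! ### The two cases of the loop lemma -/

section LoopLemma

variable {A : Type*} {n : ℕ} {t : (Fin n → A) → A}

/-- The start is prescribed even when no walk exists, since marks in runs need their labels too. -/
theorem exists_walks (r : A → A → Prop) :
    ∃ P : A → A → ℕ → ℕ → A, (∀ u v d, P u v d 0 = u) ∧
      ∀ u v d, Reach r d u v → P u v d d = v ∧ ∀ i < d, r (P u v d i) (P u v d (i + 1)) := by
  have : ∀ u v d, ∃ p : ℕ → A, p 0 = u ∧
      (Reach r d u v → p d = v ∧ ∀ i < d, r (p i) (p (i + 1))) := fun u v d => by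
    by_cases h : Reach r d u v
    · obtain ⟨p, h0, h1⟩ := h.exists_path
      exact ⟨p, h0, fun _ => h1⟩
    · exact ⟨fun _ => u, rfl, fun h' => absurd h' h⟩
  choose P h0 h1 using this
  exact ⟨P, h0, h1⟩

/-- The loop lemma for strongly connected relations with closed walks of all lengths `k ≥ 2`. -/
theorem exists_loop_of_cycles {r : A → A → Prop} {α : Fin n → Fin n → A} (hi : IsIdempotentOp t)
    (hcomp : ∀ u v : Fin n → A, (∀ i, r (u i) (v i)) → r (t u) (t v))
    (hconn : ∀ u v, ∃ k, Reach r k u v) (hcyc : ∀ k, 2 ≤ k → ∃ a, Reach r k a a)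
    (hα : ∀ i, r (α i i) (t (α i))) : ∃ a, r a a := by
  classical
  rcases Nat.eq_zero_or_pos n with rfl | hn
  · have hsub : ∀ a b : A, a = b := fun a b => by
      rw [← hi a, ← hi b]
      exact congrArg t (funext fun i => i.elim0)
    obtain ⟨a, b, hab, -⟩ := hcyc 2 le_rfl
    exact ⟨a, hsub b a ▸ hab⟩
  have : NeZero n := ⟨hn.ne'⟩
  have hlarge := exists_forall_reach hconn (hcyc 2 le_rfl) (hcyc 3 (by omega))
  let v₀ : A := α 0 0
  obtain ⟨L₀, hL₀⟩ := hlarge v₀ v₀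
  -- `K` is chosen after `c`, so gaps are not yet bounded; making `c` eventually constant keeps the
  -- set of mark values finite.
  obtain ⟨c, hcfin, hc⟩ : ∃ c : ℕ → A, (Set.range c).Finite ∧
      ∀ k, 2 ≤ k → Reach r k (c k) (c k) := by
    have : Nonempty A := ⟨v₀⟩
    choose! b hb using hcyc
    refine ⟨fun k => if k < L₀ then b k else v₀, ?_, fun k hk => ?_⟩
    · refine (((Set.finite_Iio L₀).image b).union (Set.finite_singleton v₀)).subset ?_
      rintro _ ⟨k, rfl⟩
      dsimp only
      split_ifs with h
      · exact Or.inl ⟨k, h, rfl⟩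
      · exact Or.inr rfl
    · dsimp only
      split_ifs with h
      · exact hb k hk
      · exact hL₀ k (not_lt.1 h)
  let V : Set A := Set.range c ∪ Set.range fun p : Fin n × Fin n => α p.1 p.2
  have hV : V.Finite := hcfin.union (Set.finite_range _)
  choose L hL using hlarge
  obtain ⟨K, hKb⟩ := ((hV.prod hV).image fun q => L q.1 q.2).bddAbove
  have hval : ∀ x : ℤ → Fin n, markValue K α c x ∈ V := fun x => by
    unfold markValue
    split_ifs
    · exact Or.inl ⟨_, rfl⟩
    · exact Or.inr ⟨(_, _), rfl⟩
  have hK : ∀ l, K < l → ∀ x y : ℤ → Fin n,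
      Reach r l (markValue K α c x) (markValue K α c y) := fun l hl x y =>
    hL _ _ _ ((hKb ⟨(_, _), ⟨hval x, hval y⟩, rfl⟩).trans hl.le)
  obtain ⟨P, hP, hP'⟩ := exists_walks r
  obtain ⟨B, hB⟩ := exists_window (isLocallyConstant_label (K := K) (α := α) (c := c) (P := P))
  refine exists_loop_of_labelling hi hcomp hα (label K α c P) B (3 * K + 3) (IsRun K) hB ?_ ?_
    fun x hx => label_rel hP hP' hc hK hx
  · intro x y h hx i h0 h1
    rw [← h i (by push_cast; omega), ← h (i + 1) (by push_cast; omega), hx i h0 h1]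
  · intro x hx
    simpa using label_of_isRun hP hx

/-- The loop lemma for connected non-bipartite symmetric relations. -/
theorem exists_loop_of_symmetric {r : A → A → Prop} {α : Fin n → Fin n → A}
    (hi : IsIdempotentOp t)
    (hcomp : ∀ u v : Fin n → A, (∀ i, r (u i) (v i)) → r (t u) (t v))
    (hs : ∀ u v, r u v → r v u) (hconn : ∀ u v, ∃ k, Reach r k u v)
    (hb : ¬ ∃ c : A → Bool, ∀ u v, r u v → c u ≠ c v)
    (hα : ∀ i, r (α i i) (t (α i))) : ∃ a, r a a := by
  classical
  have hodd := exists_odd_reach hs hconn hb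
  obtain ⟨hm, a, ha⟩ := Nat.find_spec hodd
  have hmin := fun k => Nat.find_min hodd (m := k)
  generalize Nat.find hodd = m at *
  obtain ⟨q, rfl⟩ := hm
  rcases Nat.eq_zero_or_pos q with rfl | hq
  · exact ⟨a, reach_one.1 ha⟩
  obtain ⟨q, rfl⟩ := Nat.exists_eq_succ_of_ne_zero hq.ne'
  obtain ⟨b, hab, -⟩ := id ha
  have heven : ∀ k, Reach r (2 * k) a a := Reach.two_mul hs hab
  -- The minimal odd length is now `2q + 3`; walks of length `2q + 1` serve as edges.
  obtain ⟨e, he⟩ := exists_loop_of_cycles (r := Reach r (2 * q + 1)) (α := α) hi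
    (Reach.compatible hcomp _)
    (fun u v => by
      obtain ⟨k, hk⟩ := hconn u v
      exact ⟨k, reach_reach (hk.odd_mul hs q)⟩)
    (fun k hk => by
      refine ⟨a, reach_reach ?_⟩
      rcases Nat.even_or_odd' k with ⟨l, rfl | rfl⟩
      · exact (heven (l * (2 * q + 1))).cast (by ring)
      -- For odd `k ≥ 3`, `k(2q + 1)` is odd and at least `2q + 3`, so the shortest odd closed walk
      -- is padded by going back and forth along an edge.
      · obtain ⟨l, rfl⟩ := Nat.exists_eq_add_of_le (show 1 ≤ l by omega)
        exact (ha.trans (heven (2 * q + 2 * l * q + l))).cast (by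
          simp only [Nat.succ_eq_add_one]; ring))
    (fun i => ((Reach.single (hα i)).odd_mul hs q).cast (by ring))
  exact absurd ⟨⟨q, rfl⟩, e, he⟩ (hmin (2 * q + 1) (by omega))

end LoopLemma

end LocalLoop

theorem mainTheorem1 {A : Type*} {n : ℕ} (t : (Fin n → A) → A) (G : Digraph A)
    (α : Fin n → Fin n → A)
    (h_idem : LocalLoop.IsIdempotentOp t)
    (h_comp : LocalLoop.IsCompatible G t)
    (h_graph :
      (LocalLoop.IsStronglyConnected G ∧
        ∀ k : ℕ, 2 ≤ k → ∃ w : Fin (k + 1) → A, LocalLoop.IsCycleWalk G w) ∨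
      (LocalLoop.IsUndirected G ∧ LocalLoop.IsStronglyConnected G ∧ ¬ LocalLoop.IsBipartite G))
    (h_edge : ∀ i : Fin n, G.Adj (α i i) (t (α i))) :
    ∃ a : A, G.Adj a a := by
  have hconn : LocalLoop.IsStronglyConnected G →
      ∀ u v, ∃ k, LocalLoop.Reach G.Adj k u v := fun h u v => by
    obtain ⟨k, w, hw, rfl, rfl⟩ := h u v
    exact ⟨k, hw.reach⟩
  rcases h_graph with ⟨hc, hcyc⟩ | ⟨hs, hc, hb⟩
  · refine LocalLoop.exists_loop_of_cycles h_idem h_comp (hconn hc) (fun k hk => ?_) h_edge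
    obtain ⟨w, hw, e⟩ := hcyc k hk
    exact ⟨w 0, by simpa [← e] using hw.reach⟩
  · exact LocalLoop.exists_loop_of_symmetric h_idem h_comp hs (hconn hc) hb h_edge
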